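/- **Partitions.** A two-coloured partition $p$ with $k\ge 0$ upper and $l\ge 0$ lower points is a partition of these $k+l$ points into blocks, together with colour words $\omega\in\{1,*\}^k$ (upper row) and $\omega'\in\{1,*\}^l$ (lower row). A through-block is a block containing both upper and lower points; $tb(p)$ is their number. For $N\ge 1$ put $[N]=\{1,\dots,N\}$. A labeling $t\in[N]^k$ of the upper row (or $t'\in[N]^l$ of the lower row) is valid if points of that row lying in the same block have equal labels. Let $T_0\subseteq[N]^k$ and $T'_0\subseteq[N]^l$ be the sets of invalid labelings. Enumerate the $r=N^{tb(p)}$ labelings of the through-blocks by elements of $[N]$ as $1,\dots,r$, and let $T_i\subseteq [N]^k$ and $T'_i\subseteq[N]^l$ be the sets of valid labelings of the upper and the lower row, respectively, that label the through-blocks according to the $i$-th one. The four mixed-coloured pair partitions are those consisting of a single block of two points, both in the same row (both upper or both lower), coloured $1*$ or $*1$. **Relations.** Write $a^1=a$ and let $a^*$ be the adjoint; empty products are $\mathbb 1$. For an $N\times N$-matrix $u=(u_{ij})$ the relations $R^{Gr}_p(u)$ are 1. $\sum_{t\in T_i}u_{t_1\gamma_1}^{\omega_1}\cdots u_{t_k\gamma_k}^{\omega_k}=\sum_{t'\in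 T'_j}u_{\gamma'_1t'_1}^{\omega'_1}\cdots u_{\gamma'_lt'_l}^{\omega'_l}$ for $1\le i,j\le r$, $\gamma\in T_j$, $\gamma'\in T'_i$; 2. $\sum_{t\in T_i}u_{t_1\gamma_1}^{\omega_1}\cdots u_{t_k\gamma_k}^{\omega_k}=0$ for $1\le i\le r$, $\gamma\in T_0$; 3. $\sum_{t'\in T'_j}u_{\gamma'_1t'_1}^{\omega'_1}\cdots u_{\gamma'_lt'_l}^{\omega'_l}=0$ for $1\le j\le r$, $\gamma'\in T'_0$. For $d\le N$ and $x=(x_{ij})_{1\le i\le N,\,1\le j\le d}$ the relations $R^{Sp}_p(x)$ are 1. $\sum_{t\in T_i}x_{t_1\gamma_1}^{\omega_1}\cdots x_{t_k\gamma_k}^{\omega_k}=\sum_{t'\in T'_i}x_{t'_1\gamma'_1}^{\omega'_1}\cdots x_{t'_l\gamma'_l}^{\omega'_l}$ for $1\le i,j\le r$, $\gamma\in T_j\cap[d]^k$, $\gamma'\in T'_j\cap[d]^l$; 2. $\sum_{t\in T_i}x_{t_1\gamma_1}^{\omega_1}\cdots x_{t_k\gamma_k}^{\omega_k}=0$ for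 $1\le i\le r$, $\gamma\in T_0\cap[d]^k$; 3. $\sum_{t'\in T'_i}x_{t'_1\gamma'_1}^{\omega'_1}\cdots x_{t'_l\gamma'_l}^{\omega'_l}=0$ for $1\le i\le r$, $\gamma'\in T'_0\cap[d]^l$. For one vector $x=(x_1,\dots,x_N)$ the relations $R^{Sp}_p(x)$ are $\sum_{t\in T_i}x_{t_1}^{\omega_1}\cdots x_{t_k}^{\omega_k}=\sum_{t'\in T'_i}x_{t'_1}^{\omega'_1}\cdots x_{t'_l}^{\omega'_l}$ for $1\le i\le r$. **Algebras.** Let $\Pi$ be a set of two-coloured partitions that contains the four mixed-coloured pair partitions. Let $C(G_N(\Pi))$, $C(X_{N,d}(\Pi))$ and $C(X_N(\Pi))$ be the universal unital $C^*$-algebras generated by elements $u_{ij}$ $(1\le i,j\le N)$, by elements $x_{ij}$ $(1\le i\le N,\ 1\le j\le d)$ and by elements $x_1,\dots,x_N$, subject to the relations $R^{Gr}_p(u)$, $R^{Sp}_p(x)$ and $R^{Sp}_p(x)$ (for one vector), respectively, for all $p\in\Pi$. (They exist, because the relations of the pair partitions bound the norms of the generators by $1$.) **Theorem.** Let $1\le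 d\le N$ and let $\Pi$ be a set of two-coloured partitions that contains the four mixed-coloured pair partitions. Then $x_{ij}\mapsto u_{ij}$ $(1\le i\le N,\ 1\le j\le d)$ defines a (unique) unital $^*$-homomorphism $C(X_{N,d}(\Pi))\to C(G_N(\Pi))$, and $x_i\mapsto u_{i1}$ $(1\le i\le N)$ defines a (unique) unital $^*$-homomorphism $C(X_N(\Pi))\to C(G_N(\Pi))$. -/

import Mathlib

noncomputable section

namespace PartitionQuantumSpace

/-! ### Two-coloured partitions and decompositions of labelings -/

/-- The two colours: `white` is the label `1`, `black` is the label `*`. -/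
inductive Colour where
  | white
  | black

/-- `a ^ 1 = a` and `a ^ * = star a`. -/
def Colour.pow {A : Type*} [Star A] : Colour → A → A
  | .white, a => a
  | .black, a => star a

/-- The other colour. -/
def Colour.flip : Colour → Colour
  | .white => .black
  | .black => .white

/-- A two-coloured partition with `k` upper points (coloured by the word `ω`) and `l` lower points
(coloured by the word `ω'`). The partition of the `k + l` points into blocks is given by the
equivalence relation of lying in the same block. -/
structure ColouredPartition where
  /-- the number of upper points -/
  k : ℕ
  /-- the number of lower points -/
  l : ℕ
  /-- the colours of the upper points -/
  ω : Fin k → Colour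
  /-- the colours of the lower points -/
  ω' : Fin l → Colour
  /-- the relation "is in the same block as" -/
  blocks : Setoid (Fin k ⊕ Fin l)

namespace ColouredPartition

variable (p : ColouredPartition)

/-- The block of an upper point. -/
def upperBlock (a : Fin p.k) : Quotient p.blocks := Quotient.mk p.blocks (Sum.inl a)

/-- The block of a lower point. -/
def lowerBlock (b : Fin p.l) : Quotient p.blocks := Quotient.mk p.blocks (Sum.inr b)

/-- The through-blocks: the blocks that contain both upper and lower points. -/
def ThroughBlock : Type :=
  {B : Quotient p.blocks // (∃ a, p.upperBlock a = B) ∧ ∃ b, p.lowerBlock b = B}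

/-- A labeling of the upper row is valid if connected upper points have equal labels. -/
def UpperValid {N : ℕ} (t : Fin p.k → Fin N) : Prop :=
  ∀ a a', p.upperBlock a = p.upperBlock a' → t a = t a'

/-- A labeling of the lower row is valid if connected lower points have equal labels. -/
def LowerValid {N : ℕ} (t' : Fin p.l → Fin N) : Prop :=
  ∀ b b', p.lowerBlock b = p.lowerBlock b' → t' b = t' b'

open Classical in
/-- The set `T_i` of the decomposition of `[N]^k`. The index `i` runs through the `N ^ tb(p)`
labelings of the through-blocks, and `T_i` consists of the valid labelings of the upper row
that label the through-blocks according to `i`. -/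
def upperT (N : ℕ) (i : p.ThroughBlock → Fin N) : Finset (Fin p.k → Fin N) :=
  Finset.univ.filter fun t =>
    p.UpperValid t ∧ ∀ (a : Fin p.k) (B : p.ThroughBlock), p.upperBlock a = B.1 → t a = i B

open Classical in
/-- The set `T'_i` of the decomposition of `[N]^l`. -/
def lowerT (N : ℕ) (i : p.ThroughBlock → Fin N) : Finset (Fin p.l → Fin N) :=
  Finset.univ.filter fun t' =>
    p.LowerValid t' ∧ ∀ (b : Fin p.l) (B : p.ThroughBlock), p.lowerBlock b = B.1 → t' b = i B

theorem mem_upperT {N : ℕ} {i : p.ThroughBlock → Fin N} {t : Fin p.k → Fin N} :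
    t ∈ p.upperT N i ↔ p.UpperValid t ∧
      ∀ (a : Fin p.k) (B : p.ThroughBlock), p.upperBlock a = B.1 → t a = i B := by
  simp [upperT]

theorem mem_lowerT {N : ℕ} {i : p.ThroughBlock → Fin N} {t' : Fin p.l → Fin N} :
    t' ∈ p.lowerT N i ↔ p.LowerValid t' ∧
      ∀ (b : Fin p.l) (B : p.ThroughBlock), p.lowerBlock b = B.1 → t' b = i B := by
  simp [lowerT]

/-- The partition with no upper and two lower points, connected, with the given colours. -/
def lowerPair (c c' : Colour) : ColouredPartition where
  k := 0
  l := 2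
  ω := ![]
  ω' := ![c, c']
  blocks := ⊤

/-- The partition with two upper and no lower points, connected, with the given colours. -/
def upperPair (c c' : Colour) : ColouredPartition where
  k := 2
  l := 0
  ω := ![c, c']
  ω' := ![]
  blocks := ⊤

/-- The four mixed-coloured pair partitions. -/
def mixedPairs : Set ColouredPartition :=
  {lowerPair .white .black, lowerPair .black .white,
    upperPair .white .black, upperPair .black .white}

end ColouredPartition

/-! ### The relations associated with a partition -/

section Relations

variable {A : Type*} [Ring A] [StarRing A]

/-- The product `y_1 ^ ω_1 ⋯ y_n ^ ω_n`, which is `1` for `n = 0`. -/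
def word {n : ℕ} (ω : Fin n → Colour) (y : Fin n → A) : A :=
  (List.ofFn fun m => (ω m).pow (y m)).prod

/-- The quantum group relations of `p` for an `N × N` matrix `u`: `GroupRel p u a b` says that
`a = b` is one of them. -/
inductive GroupRel (p : ColouredPartition) {N : ℕ} (u : Fin N → Fin N → A) : A → A → Prop
  | through (i j : p.ThroughBlock → Fin N) (γ : Fin p.k → Fin N) (γ' : Fin p.l → Fin N)
      (hγ : γ ∈ p.upperT N j) (hγ' : γ' ∈ p.lowerT N i) :
      GroupRel p u
        (∑ t ∈ p.upperT N i, word p.ω fun m => u (t m) (γ m))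
        (∑ t' ∈ p.lowerT N j, word p.ω' fun m => u (γ' m) (t' m))
  | upper (i : p.ThroughBlock → Fin N) (γ : Fin p.k → Fin N) (hγ : ¬ p.UpperValid γ) :
      GroupRel p u (∑ t ∈ p.upperT N i, word p.ω fun m => u (t m) (γ m)) 0
  | lower (j : p.ThroughBlock → Fin N) (γ' : Fin p.l → Fin N) (hγ' : ¬ p.LowerValid γ') :
      GroupRel p u (∑ t' ∈ p.lowerT N j, word p.ω' fun m => u (γ' m) (t' m)) 0

/-- The quantum space relations of `p` for a `d`-tuple `x` of vectors of length `N`, where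
`d ≤ N`: `SpaceRel p h x a b` says that `a = b` is one of them. Labelings with values in `[d]`
are regarded as labelings with values in `[N]` through `Fin.castLE h`. -/
inductive SpaceRel (p : ColouredPartition) {N d : ℕ} (h : d ≤ N) (x : Fin N → Fin d → A) :
    A → A → Prop
  | through (i j : p.ThroughBlock → Fin N) (γ : Fin p.k → Fin d) (γ' : Fin p.l → Fin d)
      (hγ : (fun m => Fin.castLE h (γ m)) ∈ p.upperT N j)
      (hγ' : (fun m => Fin.castLE h (γ' m)) ∈ p.lowerT N j) :
      SpaceRel p h x
        (∑ t ∈ p.upperT N i, word p.ω fun m => x (t m) (γ m))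
        (∑ t' ∈ p.lowerT N i, word p.ω' fun m => x (t' m) (γ' m))
  | upper (i : p.ThroughBlock → Fin N) (γ : Fin p.k → Fin d)
      (hγ : ¬ p.UpperValid fun m => Fin.castLE h (γ m)) :
      SpaceRel p h x (∑ t ∈ p.upperT N i, word p.ω fun m => x (t m) (γ m)) 0
  | lower (i : p.ThroughBlock → Fin N) (γ' : Fin p.l → Fin d)
      (hγ' : ¬ p.LowerValid fun m => Fin.castLE h (γ' m)) :
      SpaceRel p h x (∑ t' ∈ p.lowerT N i, word p.ω' fun m => x (t' m) (γ' m)) 0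

/-- The quantum space relations of `p` for one vector `x` of length `N`. -/
inductive VectorRel (p : ColouredPartition) {N : ℕ} (x : Fin N → A) : A → A → Prop
  | through (i : p.ThroughBlock → Fin N) :
      VectorRel p x
        (∑ t ∈ p.upperT N i, word p.ω fun m => x (t m))
        (∑ t' ∈ p.lowerT N i, word p.ω' fun m => x (t' m))

end Relations

/-! ### C⋆-seminorms and their completions -/

/-- A C⋆-seminorm on a unital complex ⋆-algebra. -/
structure CStarSeminorm (A : Type*) [Ring A] [StarRing A] [Algebra ℂ A]
    extends Seminorm ℂ A where
  mul_le' : ∀ a b, toFun (a * b) ≤ toFun a * toFun b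
  star_mul_self' : ∀ a, toFun (star a * a) = toFun a ^ 2

namespace CStarSeminorm

section Basic

variable {A : Type*} [Ring A] [StarRing A] [Algebra ℂ A]

instance : CoeFun (CStarSeminorm A) fun _ => A → ℝ := ⟨fun p => p.toFun⟩

theorem nonneg (p : CStarSeminorm A) (a : A) : 0 ≤ p a := apply_nonneg p.toSeminorm a

theorem add_le (p : CStarSeminorm A) (a b : A) : p (a + b) ≤ p a + p b := p.add_le' a b

theorem smul_eq (p : CStarSeminorm A) (c : ℂ) (a : A) : p (c • a) = ‖c‖ * p a := p.smul' c a

theorem le_map_star (p : CStarSeminorm A) (a : A) : p a ≤ p (star a) := by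
  have h : p a * p a ≤ p (star a) * p a := by
    rw [← sq, ← p.star_mul_self' a]
    exact p.mul_le' _ _
  rcases (p.nonneg a).eq_or_lt with h0 | h0
  · rw [← h0]
    exact p.nonneg _
  · exact le_of_mul_le_mul_right h h0

theorem map_star (p : CStarSeminorm A) (a : A) : p (star a) = p a :=
  le_antisymm (by simpa using p.le_map_star (star a)) (p.le_map_star a)

theorem map_one_le (p : CStarSeminorm A) : p 1 ≤ 1 := by
  have h := p.star_mul_self' 1
  rw [star_one, one_mul] at h
  nlinarith [p.nonneg 1]

/-- The zero seminorm. -/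
instance : Zero (CStarSeminorm A) :=
  ⟨{ (0 : Seminorm ℂ A) with
      mul_le' := fun _ _ => (mul_zero (0 : ℝ)).ge
      star_mul_self' := fun _ => (zero_pow (M₀ := ℝ) two_ne_zero).symm }⟩

end Basic

section Completion

variable {A : Type*} [Ring A] [StarRing A] [Algebra ℂ A] (p : CStarSeminorm A)

/-- The algebra `A`, seminormed by `p`. -/
def Carrier (_p : CStarSeminorm A) : Type _ := A

/-- The identity map. -/
def toCarrier (a : A) : p.Carrier := a

instance : SeminormedRing p.Carrier where
  __ := (inferInstance : Ring A)
  __ := p.toSeminorm.toAddGroupSeminorm.toSeminormedAddCommGroup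
  norm_mul_le := p.mul_le'

instance : StarRing p.Carrier := inferInstanceAs (StarRing A)

instance : NormedAlgebra ℂ p.Carrier where
  __ := (inferInstance : Algebra ℂ A)
  norm_smul_le c a := (p.smul_eq c a).le

instance [StarModule ℂ A] : StarModule ℂ p.Carrier := inferInstanceAs (StarModule ℂ A)

instance : NormedStarGroup p.Carrier where
  norm_star_le a := (p.map_star a).le

/-- The separated completion of `A` with respect to `p`. -/
abbrev Completion : Type _ := UniformSpace.Completion p.Carrier

instance : NormedAlgebra ℂ p.Completion where
  norm_smul_le := norm_smul_le

/-- The canonical map from `A` to its completion. -/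
def of (a : A) : p.Completion := ((p.toCarrier a : p.Carrier) : UniformSpace.Completion p.Carrier)

theorem uniformContinuous_star_carrier : UniformContinuous (star : p.Carrier → p.Carrier) :=
  star_isometry.uniformContinuous

/-- The involution of the completion is the continuous extension of the involution of `A`. -/
instance : Star p.Completion := ⟨UniformSpace.Completion.map (star : p.Carrier → p.Carrier)⟩

theorem continuous_star_completion : Continuous (star : p.Completion → p.Completion) :=
  UniformSpace.Completion.continuous_map

theorem star_of (a : A) : star (p.of a) = p.of (star a) :=
  UniformSpace.Completion.map_coe p.uniformContinuous_star_carrier _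

theorem of_mul (a b : A) : p.of (a * b) = p.of a * p.of b :=
  UniformSpace.Completion.coe_mul (α := p.Carrier) a b

theorem of_add (a b : A) : p.of (a + b) = p.of a + p.of b :=
  UniformSpace.Completion.coe_add (α := p.Carrier) a b

theorem of_one : p.of 1 = 1 := rfl

theorem of_smul (c : ℂ) (a : A) : p.of (c • a) = c • p.of a :=
  UniformSpace.Completion.coe_smul (X := p.Carrier) c a

theorem norm_of (a : A) : ‖p.of a‖ = p a := UniformSpace.Completion.norm_coe (E := p.Carrier) a

theorem completion_induction {P : p.Completion → Prop} (a : p.Completion)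
    (hc : IsClosed {a | P a}) (h : ∀ a : A, P (p.of a)) : P a :=
  UniformSpace.Completion.induction_on a hc h

theorem completion_induction₂ {P : p.Completion → p.Completion → Prop} (a b : p.Completion)
    (hc : IsClosed {z : p.Completion × p.Completion | P z.1 z.2})
    (h : ∀ a b : A, P (p.of a) (p.of b)) : P a b :=
  UniformSpace.Completion.induction_on₂ a b hc h

instance : StarRing p.Completion where
  star_involutive a := by
    refine p.completion_induction a (P := fun a => star (star a) = a)
      (isClosed_eq ?_ continuous_id) fun a => ?_
    · exact p.continuous_star_completion.comp p.continuous_star_completion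
    · rw [star_of, star_of, star_star]
  star_mul a b := by
    refine p.completion_induction₂ a b
      (P := fun a b => star (a * b) = star b * star a)
      (isClosed_eq ?_ ?_) fun a b => ?_
    · exact p.continuous_star_completion.comp continuous_mul
    · exact (p.continuous_star_completion.comp continuous_snd).mul
        (p.continuous_star_completion.comp continuous_fst)
    · rw [← of_mul, star_of, star_of, star_of, ← of_mul, star_mul]
  star_add a b := by
    refine p.completion_induction₂ a b
      (P := fun a b => star (a + b) = star a + star b)
      (isClosed_eq ?_ ?_) fun a b => ?_
    · exact p.continuous_star_completion.comp continuous_add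
    · exact (p.continuous_star_completion.comp continuous_fst).add
        (p.continuous_star_completion.comp continuous_snd)
    · rw [← of_add, star_of, star_of, star_of, ← of_add, star_add]

instance : CStarRing p.Completion where
  norm_mul_self_le a := by
    refine p.completion_induction a (P := fun a => ‖a‖ * ‖a‖ ≤ ‖star a * a‖)
      (isClosed_le ?_ ?_) fun a => ?_
    · fun_prop
    · exact (p.continuous_star_completion.mul continuous_id).norm
    · rw [star_of, ← of_mul, norm_of, norm_of, p.star_mul_self', sq]

instance [StarModule ℂ A] : StarModule ℂ p.Completion where
  star_smul c a := by
    refine p.completion_induction a (P := fun a => star (c • a) = star c • star a)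
      (isClosed_eq ?_ ?_) fun a => ?_
    · exact p.continuous_star_completion.comp (continuous_const_smul c)
    · exact p.continuous_star_completion.const_smul (star c)
    · rw [← of_smul, star_of, star_of, ← of_smul, star_smul]

instance [StarModule ℂ A] : CStarAlgebra p.Completion where

/-- If `∑ a_i a_i⋆ = 1` modulo `p`, then `p a_i ≤ 1`. -/
theorem le_one_of_sum_eq_one [StarModule ℂ A] {n : ℕ} (a : Fin n → A)
    (h : p ((1 : A) - ∑ i, a i * star (a i)) = 0) (i : Fin n) : p (a i) ≤ 1 := by
  let f : A →+ p.Completion := ⟨⟨p.of, rfl⟩, p.of_add⟩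
  have h1 : (1 : p.Completion) = ∑ i, p.of (a i) * star (p.of (a i)) := by
    have h2 : f (1 - ∑ i, a i * star (a i)) = 0 := by
      rw [← norm_eq_zero]
      exact (p.norm_of _).trans h
    rw [map_sub, map_sum, sub_eq_zero] at h2
    refine Eq.trans ?_ (h2.trans (Finset.sum_congr rfl fun i _ => ?_))
    · exact p.of_one.symm
    · rw [star_of, ← of_mul]
      rfl
  let _ := CStarAlgebra.spectralOrder p.Completion
  let _ := CStarAlgebra.spectralOrderedRing p.Completion
  have h3 : p.of (a i) * star (p.of (a i)) ≤ 1 := by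
    rw [h1]
    exact Finset.single_le_sum (f := fun i => p.of (a i) * star (p.of (a i)))
      (fun j _ => mul_star_self_nonneg _) (Finset.mem_univ i)
  have h4 : ‖p.of (a i) * star (p.of (a i))‖ ≤ 1 :=
    CStarAlgebra.norm_le_one_iff_of_nonneg _ (mul_star_self_nonneg _) |>.2 h3
  rw [CStarRing.norm_self_mul_star, norm_of] at h4
  nlinarith [p.nonneg (a i)]

end Completion

end CStarSeminorm

/-! ### Universal C⋆-algebras -/

/-- The free unital complex ⋆-algebra on `ι`: the noncommutative polynomials in the letters
`(i, white)`, standing for the generator `i`, and `(i, black)`, standing for its adjoint. -/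
abbrev FreeStarAlgebra (ι : Type*) : Type _ := MonoidAlgebra ℂ (FreeMonoid (ι × Colour))

namespace FreeStarAlgebra

variable {ι : Type*}

/-- The generators. -/
def gen (i : ι) : FreeStarAlgebra ι := MonoidAlgebra.single (FreeMonoid.of (i, .white)) 1

/-- The adjoint of a word: reverse the order of the letters and flip their colours. -/
def wordStar (w : FreeMonoid (ι × Colour)) : FreeMonoid (ι × Colour) :=
  (FreeMonoid.map (fun s => (s.1, s.2.flip)) w).reverse

theorem wordStar_wordStar (w : FreeMonoid (ι × Colour)) : wordStar (wordStar w) = w := by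
  have h : (fun s : ι × Colour => (s.1, s.2.flip)) ∘ (fun s => (s.1, s.2.flip)) = id := by
    funext s
    rcases s with ⟨i, c⟩
    cases c <;> rfl
  have key : ∀ v : List (ι × Colour), (List.map (fun s => (s.1, s.2.flip))
      (List.map (fun s => (s.1, s.2.flip)) v).reverse).reverse = v := fun v => by
    rw [List.map_reverse, List.reverse_reverse, List.map_map, h, List.map_id]
  exact key w

theorem wordStar_mul (v w : FreeMonoid (ι × Colour)) :
    wordStar (v * w) = wordStar w * wordStar v := by
  simp [wordStar, FreeMonoid.reverse_mul]

/-- The adjoint: conjugate-linear, and `wordStar` on words. -/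
def starHom : FreeStarAlgebra ι →+ FreeStarAlgebra ι where
  toFun f := f.coeff.sum fun w c => MonoidAlgebra.single (wordStar w) (star c)
  map_zero' := by simp
  map_add' f g := by
    rw [MonoidAlgebra.coeff_add]
    exact Finsupp.sum_add_index' (by simp) (by simp)

theorem starHom_single (w : FreeMonoid (ι × Colour)) (c : ℂ) :
    starHom (MonoidAlgebra.single w c) = MonoidAlgebra.single (wordStar w) (star c) := by
  simp [starHom]

instance : StarRing (FreeStarAlgebra ι) where
  star := starHom
  star_involutive f := by
    induction f using MonoidAlgebra.induction_linear with
    | zero => simp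
    | add f g hf hg => rw [map_add, map_add, hf, hg]
    | single w c => rw [starHom_single, starHom_single, wordStar_wordStar, star_star]
  star_mul f g := by
    induction f using MonoidAlgebra.induction_linear with
    | zero => simp
    | add f₁ f₂ h₁ h₂ => rw [add_mul, map_add, map_add, mul_add, h₁, h₂]
    | single v b =>
      induction g using MonoidAlgebra.induction_linear with
      | zero => simp
      | add g₁ g₂ h₁ h₂ => rw [mul_add, map_add, map_add, add_mul, h₁, h₂]
      | single w c =>
        rw [MonoidAlgebra.single_mul_single, starHom_single, starHom_single, starHom_single,
          MonoidAlgebra.single_mul_single, wordStar_mul, star_mul]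
  star_add := starHom.map_add

instance : StarModule ℂ (FreeStarAlgebra ι) where
  star_smul c f := by
    change starHom (c • f) = star c • starHom f
    induction f using MonoidAlgebra.induction_linear with
    | zero => simp
    | add f g hf hg => rw [smul_add, map_add, map_add, smul_add, hf, hg]
    | single w b => simp [starHom_single]

end FreeStarAlgebra

/-- The C⋆-seminorms on the free ⋆-algebra in which the relations `R` hold. -/
def AdmissibleSeminorm {ι : Type*} (R : FreeStarAlgebra ι → FreeStarAlgebra ι → Prop) : Type _ :=
  {p : CStarSeminorm (FreeStarAlgebra ι) // ∀ a b, R a b → p (a - b) = 0}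

/-- The condition for the universal C⋆-algebra to exist: the relations `R` bound the norms
of the generators. -/
def BoundedRelations {ι : Type*} (R : FreeStarAlgebra ι → FreeStarAlgebra ι → Prop) : Prop :=
  ∀ i, ∃ C : ℝ, ∀ p : AdmissibleSeminorm R, p.1 (FreeStarAlgebra.gen i) ≤ C

section Universal

variable {ι : Type*} {R : FreeStarAlgebra ι → FreeStarAlgebra ι → Prop}

instance : Nonempty (AdmissibleSeminorm R) := ⟨⟨0, fun _ _ _ => rfl⟩⟩

theorem BoundedRelations.exists_bound (hR : BoundedRelations R) (a : FreeStarAlgebra ι) :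
    ∃ C : ℝ, ∀ p : AdmissibleSeminorm R, p.1 a ≤ C := by
  have hw : ∀ w : FreeMonoid (ι × Colour),
      ∃ C : ℝ, ∀ p : AdmissibleSeminorm R, p.1 (MonoidAlgebra.single w 1) ≤ C := by
    intro w
    induction w using FreeMonoid.inductionOn with
    | one => exact ⟨1, fun p => p.1.map_one_le⟩
    | of s =>
      obtain ⟨i, c⟩ := s
      obtain ⟨C, hC⟩ := hR i
      refine ⟨C, fun p => ?_⟩
      cases c with
      | white => exact hC p
      | black =>
        have h : (MonoidAlgebra.single (FreeMonoid.of (i, Colour.black)) 1 : FreeStarAlgebra ι)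
            = star (FreeStarAlgebra.gen i) := by
          change _ = FreeStarAlgebra.starHom _
          rw [FreeStarAlgebra.gen, FreeStarAlgebra.starHom_single, star_one]
          rfl
        rw [h, p.1.map_star]
        exact hC p
    | mul v w hv hw =>
      obtain ⟨C, hC⟩ := hv
      obtain ⟨D, hD⟩ := hw
      refine ⟨C * D, fun p => ?_⟩
      have h : (MonoidAlgebra.single (v * w) 1 : FreeStarAlgebra ι)
          = MonoidAlgebra.single v 1 * MonoidAlgebra.single w 1 := by
        rw [MonoidAlgebra.single_mul_single, one_mul]
      rw [h]
      exact (p.1.mul_le' _ _).trans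
        (mul_le_mul (hC p) (hD p) (p.1.nonneg _) ((p.1.nonneg _).trans (hC p)))
  induction a using MonoidAlgebra.induction_linear with
  | zero => exact ⟨0, fun p => (map_zero p.1.toSeminorm).le⟩
  | add f g hf hg =>
    obtain ⟨C, hC⟩ := hf
    obtain ⟨D, hD⟩ := hg
    exact ⟨C + D, fun p => (p.1.add_le f g).trans (add_le_add (hC p) (hD p))⟩
  | single w c =>
    obtain ⟨C, hC⟩ := hw w
    refine ⟨‖c‖ * C, fun p => ?_⟩
    have h : (MonoidAlgebra.single w c : FreeStarAlgebra ι) = c • MonoidAlgebra.single w 1 := by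
      simp
    rw [h, p.1.smul_eq]
    exact mul_le_mul_of_nonneg_left (hC p) (norm_nonneg c)

theorem BoundedRelations.bddAbove (hR : BoundedRelations R) (a : FreeStarAlgebra ι) :
    BddAbove (Set.range fun p : AdmissibleSeminorm R => p.1 a) := by
  obtain ⟨C, hC⟩ := hR.exists_bound a
  exact ⟨C, by rintro _ ⟨p, rfl⟩; exact hC p⟩

theorem BoundedRelations.le_iSup (hR : BoundedRelations R) (p : AdmissibleSeminorm R)
    (a : FreeStarAlgebra ι) : p.1 a ≤ ⨆ q : AdmissibleSeminorm R, q.1 a :=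
  le_ciSup (hR.bddAbove a) p

theorem iSup_admissible_nonneg (a : FreeStarAlgebra ι) :
    0 ≤ ⨆ q : AdmissibleSeminorm R, q.1 a :=
  Real.iSup_nonneg fun p => p.1.nonneg a

/-- The universal C⋆-seminorm: the supremum of all C⋆-seminorms in which the relations hold. -/
def universalSeminorm (hR : BoundedRelations R) : CStarSeminorm (FreeStarAlgebra ι) where
  toFun a := ⨆ p : AdmissibleSeminorm R, p.1 a
  map_zero' := by
    have h : ∀ p : AdmissibleSeminorm R, p.1 0 = 0 := fun p => map_zero p.1.toSeminorm
    simp [h]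
  add_le' a b := ciSup_le fun p =>
    (p.1.add_le a b).trans (add_le_add (hR.le_iSup p a) (hR.le_iSup p b))
  neg' a := by
    have h : ∀ p : AdmissibleSeminorm R, p.1 (-a) = p.1 a := fun p => map_neg_eq_map p.1.toSeminorm a
    simp [h]
  smul' c a := by
    have h : ∀ p : AdmissibleSeminorm R, p.1 (c • a) = ‖c‖ * p.1 a := fun p => p.1.smul_eq c a
    simp only [h]
    exact (Real.mul_iSup_of_nonneg (norm_nonneg c) _).symm
  mul_le' a b := ciSup_le fun p => (p.1.mul_le' a b).trans
    (mul_le_mul (hR.le_iSup p a) (hR.le_iSup p b) (p.1.nonneg b) (iSup_admissible_nonneg a))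
  star_mul_self' a := by
    have h : ∀ p : AdmissibleSeminorm R, p.1 (star a * a) = p.1 a ^ 2 :=
      fun p => p.1.star_mul_self' a
    refine le_antisymm (ciSup_le fun p => ?_) ?_
    · rw [h]
      exact pow_le_pow_left₀ (p.1.nonneg a) (hR.le_iSup p a) 2
    · rw [← Real.le_sqrt (iSup_admissible_nonneg a) (iSup_admissible_nonneg _)]
      refine ciSup_le fun p => Real.le_sqrt_of_sq_le ?_
      rw [← h]
      exact hR.le_iSup p (star a * a)

/-- The universal unital C⋆-algebra `C⋆(ι | R)` with generators `ι` and relations `R`: the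
separated completion of the free ⋆-algebra with respect to the universal C⋆-seminorm. -/
abbrev UniversalCStarAlgebra (hR : BoundedRelations R) : Type _ :=
  (universalSeminorm hR).Completion

/-- The generators of the universal C⋆-algebra. -/
def UniversalCStarAlgebra.gen (hR : BoundedRelations R) (i : ι) : UniversalCStarAlgebra hR :=
  (universalSeminorm hR).of (FreeStarAlgebra.gen i)

end Universal

/-! ### Easy quantum groups and partition quantum spaces -/

section Objects

open ColouredPartition

/-- The relations of the easy quantum group `G_N(P)`, for the generators `u_ij`. -/
def easyRelations (N : ℕ) (P : Set ColouredPartition) :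
    FreeStarAlgebra (Fin N × Fin N) → FreeStarAlgebra (Fin N × Fin N) → Prop :=
  fun a b => ∃ p ∈ P, GroupRel p (fun i j => FreeStarAlgebra.gen (i, j)) a b

/-- The relations of the partition quantum space `X_{N,d}(P)`, for the generators `x_ij`. -/
def spaceRelations (N d : ℕ) (hdN : d ≤ N) (P : Set ColouredPartition) :
    FreeStarAlgebra (Fin N × Fin d) → FreeStarAlgebra (Fin N × Fin d) → Prop :=
  fun a b => ∃ p ∈ P, SpaceRel p hdN (fun i j => FreeStarAlgebra.gen (i, j)) a b

/-- The relations of the partition quantum space `X_N(P)` of one vector, for the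
generators `x_i`. -/
def vectorRelations (N : ℕ) (P : Set ColouredPartition) :
    FreeStarAlgebra (Fin N) → FreeStarAlgebra (Fin N) → Prop :=
  fun a b => ∃ p ∈ P, VectorRel p FreeStarAlgebra.gen a b

instance (c c' : Colour) : IsEmpty (lowerPair c c').ThroughBlock :=
  ⟨fun B => B.2.1.choose.elim0⟩

theorem mem_upperT_lowerPair (c c' : Colour) {N : ℕ}
    (i : (lowerPair c c').ThroughBlock → Fin N) (t : Fin (lowerPair c c').k → Fin N) :
    t ∈ (lowerPair c c').upperT N i := by
  rw [mem_upperT]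
  exact ⟨fun a => Fin.elim0 a, fun a => Fin.elim0 a⟩

theorem sum_upperT_lowerPair {A : Type*} [Ring A] [StarRing A] (c c' : Colour) {N : ℕ}
    (i : (lowerPair c c').ThroughBlock → Fin N)
    (y : (Fin (lowerPair c c').k → Fin N) → Fin (lowerPair c c').k → A) :
    ∑ t ∈ (lowerPair c c').upperT N i, word (lowerPair c c').ω (y t) = 1 := by
  refine (Finset.sum_eq_single_of_mem (fun a => Fin.elim0 a) (mem_upperT_lowerPair c c' i _)
    fun t _ ht => (ht (funext fun a => Fin.elim0 a)).elim).trans ?_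
  rfl

theorem mem_lowerT_lowerPair (c c' : Colour) {N : ℕ}
    (i : (lowerPair c c').ThroughBlock → Fin N) (t : Fin (lowerPair c c').l → Fin N) :
    t ∈ (lowerPair c c').lowerT N i ↔ t (0 : Fin 2) = t (1 : Fin 2) := by
  rw [mem_lowerT]
  constructor
  · rintro ⟨h, -⟩
    exact h (0 : Fin 2) (1 : Fin 2) (Quotient.sound trivial)
  · intro h
    refine ⟨fun b b' _ => ?_, fun _ B => isEmptyElim B⟩
    have key : ∀ (t : Fin 2 → Fin N), t 0 = t 1 → ∀ b b' : Fin 2, t b = t b' := by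
      intro t h b b'
      fin_cases b <;> fin_cases b' <;> simp [h]
    exact key t h b b'

theorem sum_lowerT_lowerPair {A : Type*} [Ring A] [StarRing A] {N : ℕ}
    (i : (lowerPair .white .black).ThroughBlock → Fin N) (y : Fin N → A) :
    ∑ t ∈ (lowerPair .white .black).lowerT N i,
      word (lowerPair .white .black).ω' (fun m => y (t m)) = ∑ s, y s * star (y s) := by
  symm
  refine Finset.sum_bij (fun s _ => (fun _ => s : Fin 2 → Fin N)) ?_ ?_ ?_ ?_
  · intro s _
    exact (mem_lowerT_lowerPair _ _ i _).2 rfl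
  · intro s _ s' _ h
    exact congrFun h (0 : Fin 2)
  · intro t ht
    have h := (mem_lowerT_lowerPair _ _ i t).1 ht
    refine ⟨t (0 : Fin 2), Finset.mem_univ _, funext fun m => ?_⟩
    have key : ∀ (t : Fin 2 → Fin N), t 0 = t 1 → ∀ m : Fin 2, t 0 = t m := by
      intro t h m
      fin_cases m <;> simp [h]
    exact key t h m
  · intro s _
    change _ = (List.ofFn fun m : Fin 2 => (![Colour.white, Colour.black] m).pow (y s)).prod
    simp [Colour.pow]

theorem boundedRelations_of_sum {ι : Type*}
    {R : FreeStarAlgebra ι → FreeStarAlgebra ι → Prop}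
    (h : ∀ i, ∃ (N : ℕ) (y : Fin N → FreeStarAlgebra ι) (s : Fin N),
      y s = FreeStarAlgebra.gen i ∧ R 1 (∑ s, y s * star (y s))) : BoundedRelations R := by
  intro i
  obtain ⟨N, y, s, hs, hR⟩ := h i
  exact ⟨1, fun p => hs ▸ p.1.le_one_of_sum_eq_one y (p.2 _ _ hR) s⟩

theorem easyRelations_bounded (N : ℕ) {P : Set ColouredPartition} (hP : mixedPairs ⊆ P) :
    BoundedRelations (easyRelations N P) := by
  refine boundedRelations_of_sum fun ⟨i, j⟩ =>
    ⟨N, fun s => FreeStarAlgebra.gen (i, s), j, rfl, lowerPair .white .black,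
      hP (by simp [mixedPairs]), ?_⟩
  have h := GroupRel.through (p := lowerPair .white .black)
    (u := fun i j : Fin N => FreeStarAlgebra.gen (i, j)) isEmptyElim isEmptyElim
    (fun a => Fin.elim0 a) (fun _ => i) ?_ ((mem_lowerT_lowerPair _ _ _ _).2 rfl)
  · rwa [sum_upperT_lowerPair, sum_lowerT_lowerPair _ fun s => FreeStarAlgebra.gen (i, s)] at h
  · exact mem_upperT_lowerPair _ _ _ _

theorem spaceRelations_bounded (N d : ℕ) (hdN : d ≤ N) {P : Set ColouredPartition}
    (hP : mixedPairs ⊆ P) : BoundedRelations (spaceRelations N d hdN P) := by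
  refine boundedRelations_of_sum fun ⟨i, j⟩ =>
    ⟨N, fun s => FreeStarAlgebra.gen (s, j), i, rfl, lowerPair .white .black,
      hP (by simp [mixedPairs]), ?_⟩
  have h := SpaceRel.through (p := lowerPair .white .black) (h := hdN)
    (x := fun (i : Fin N) (j : Fin d) => FreeStarAlgebra.gen (i, j)) isEmptyElim isEmptyElim
    (fun a => Fin.elim0 a) (fun _ => j) ?_ ((mem_lowerT_lowerPair _ _ _ _).2 rfl)
  · rwa [sum_upperT_lowerPair, sum_lowerT_lowerPair _ fun s => FreeStarAlgebra.gen (s, j)] at h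
  · exact mem_upperT_lowerPair _ _ _ _

theorem vectorRelations_bounded (N : ℕ) {P : Set ColouredPartition} (hP : mixedPairs ⊆ P) :
    BoundedRelations (vectorRelations N P) := by
  refine boundedRelations_of_sum fun i =>
    ⟨N, FreeStarAlgebra.gen, i, rfl, lowerPair .white .black, hP (by simp [mixedPairs]), ?_⟩
  have h := VectorRel.through (p := lowerPair .white .black)
    (x := (FreeStarAlgebra.gen : Fin N → _)) isEmptyElim
  rwa [sum_upperT_lowerPair, sum_lowerT_lowerPair] at h

variable (N d : ℕ) (hdN : d ≤ N) (P : Set ColouredPartition) (hP : mixedPairs ⊆ P)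

/-- The C⋆-algebra `C(G_N(P))` of the easy quantum group `G_N(P)`. -/
abbrev EasyQuantumGroup : Type := UniversalCStarAlgebra (easyRelations_bounded N hP)

/-- The matrix of generators of `C(G_N(P))`. -/
def EasyQuantumGroup.u (i j : Fin N) : EasyQuantumGroup N P hP :=
  UniversalCStarAlgebra.gen (easyRelations_bounded N hP) (i, j)

/-- The C⋆-algebra `C(X_{N,d}(P))` of the partition quantum space of `d` vectors. -/
abbrev PartitionSpace : Type := UniversalCStarAlgebra (spaceRelations_bounded N d hdN hP)

/-- The generators of `C(X_{N,d}(P))`. -/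
def PartitionSpace.x (i : Fin N) (j : Fin d) : PartitionSpace N d hdN P hP :=
  UniversalCStarAlgebra.gen (spaceRelations_bounded N d hdN hP) (i, j)

/-- The C⋆-algebra `C(X_N(P))` of the partition quantum space of one vector. -/
abbrev OneVectorSpace : Type := UniversalCStarAlgebra (vectorRelations_bounded N hP)

/-- The generators of `C(X_N(P))`. -/
def OneVectorSpace.x (i : Fin N) : OneVectorSpace N P hP :=
  UniversalCStarAlgebra.gen (vectorRelations_bounded N hP) i

end Objects

end PartitionQuantumSpace

end

/-! By the universal property of the source (`existsUnique_hom`) it suffices that the first `d`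
columns of `u`, or its first column alone, satisfy the space relations.

Let `T` be the 0/1 matrix of `p` (`intertwiner`) and write `u^ω` for the tensor power. The group
relations of `p` are the entries of `T u^ω = u^ω' T` (`intertwiner_mul_tensorPower`). The
mixed-coloured pairs make `u` and its conjugate unitary, hence all tensor powers too, so taking
adjoints gives the reflected equation `u^ω T* = T* u^ω'`
(`tensorPower_mul_conjTranspose_intertwiner`).

The group relations couple column sums over the upper row to row sums over the lower row, whereas
the space relations compare column sums with column sums. The bridge is a double count
(`sum_upperT_eq_sum_lowerT`). For `γ` in `T_j`, the column sum of `u^ω` over `T_i` does not depend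
on `γ`, by the group relations. For `δ` in `T_i`, the row sum of `u^ω` over `T_j` equals the lower
column sum over `T'_i`, by the reflected equation. Summing the entries of `u^ω` over `T_i × T_j` in
both orders gives `|T_j|` times the upper sum and `|T_i|` times the lower one; the cardinalities
agree (`card_upperT`) and are nonzero, so they cancel over `ℂ`. The vanishing space relations are a
group relation in the upper case and an entry of the reflected equation in the lower case. -/

namespace PartitionQuantumSpace

open ColouredPartition
open scoped Matrix

/-! ### Images of the relations under ⋆-homomorphisms -/

section Map

variable {A B : Type*} [Ring A] [StarRing A] [Algebra ℂ A] [Ring B] [StarRing B] [Algebra ℂ B]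

theorem Colour.map_pow (f : A →⋆ₐ[ℂ] B) (c : Colour) (a : A) : f (c.pow a) = c.pow (f a) := by
  cases c
  · rfl
  · exact map_star f a

theorem map_word (f : A →⋆ₐ[ℂ] B) {n : ℕ} (ω : Fin n → Colour) (y : Fin n → A) :
    f (word ω y) = word ω fun m => f (y m) := by
  rw [word, word, map_list_prod, List.map_ofFn]
  congr 2
  funext m
  exact Colour.map_pow f _ _

/-- The direction is opposite to that of `SpaceRel.map`: the group relations are known in the free
algebra and used in its completion, so each relation among images has to be traced back to one among
generators. -/
theorem GroupRel.exists_of_map (f : A →⋆ₐ[ℂ] B) {p : ColouredPartition} {N : ℕ}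
    {u : Fin N → Fin N → A} {a' b' : B} (h : GroupRel p (fun i j => f (u i j)) a' b') :
    ∃ a b, GroupRel p u a b ∧ f a = a' ∧ f b = b' := by
  cases h with
  | through i j γ γ' hγ hγ' =>
    exact ⟨_, _, .through i j γ γ' hγ hγ', by simp only [map_sum, map_word],
      by simp only [map_sum, map_word]⟩
  | upper i γ hγ =>
    exact ⟨_, _, .upper i γ hγ, by simp only [map_sum, map_word], map_zero f⟩
  | lower j γ' hγ' =>
    exact ⟨_, _, .lower j γ' hγ', by simp only [map_sum, map_word], map_zero f⟩

theorem SpaceRel.map (f : A →⋆ₐ[ℂ] B) {p : ColouredPartition} {N d : ℕ} {hdN : d ≤ N}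
    {x : Fin N → Fin d → A} {a b : A} (h : SpaceRel p hdN x a b) :
    SpaceRel p hdN (fun i j => f (x i j)) (f a) (f b) := by
  cases h with
  | through i j γ γ' hγ hγ' =>
    simp only [map_sum, map_word]
    exact .through i j γ γ' hγ hγ'
  | upper i γ hγ =>
    simp only [map_sum, map_word, map_zero]
    exact .upper i γ hγ
  | lower i γ' hγ' =>
    simp only [map_sum, map_word, map_zero]
    exact .lower i γ' hγ'

theorem VectorRel.map (f : A →⋆ₐ[ℂ] B) {p : ColouredPartition} {N : ℕ}
    {x : Fin N → A} {a b : A} (h : VectorRel p x a b) :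
    VectorRel p (fun i => f (x i)) (f a) (f b) := by
  cases h with
  | through i =>
    simp only [map_sum, map_word]
    exact .through i

end Map

/-! ### The labelings of the rows of a partition -/

namespace ColouredPartition

variable (p : ColouredPartition) {N : ℕ}

theorem UpperValid.exists_mem_upperT {p : ColouredPartition} {t : Fin p.k → Fin N}
    (ht : p.UpperValid t) : ∃ i, t ∈ p.upperT N i := by
  refine ⟨fun B => t B.2.1.choose, (p.mem_upperT).2 ⟨ht, fun a B h => ht _ _ ?_⟩⟩
  rw [h, B.2.1.choose_spec]

theorem LowerValid.exists_mem_lowerT {p : ColouredPartition} {t' : Fin p.l → Fin N}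
    (ht : p.LowerValid t') : ∃ i, t' ∈ p.lowerT N i := by
  refine ⟨fun B => t' B.2.2.choose, (p.mem_lowerT).2 ⟨ht, fun b B h => ht _ _ ?_⟩⟩
  rw [h, B.2.2.choose_spec]

theorem upperT_index_unique {t : Fin p.k → Fin N} {i j : p.ThroughBlock → Fin N}
    (hi : t ∈ p.upperT N i) (hj : t ∈ p.upperT N j) : i = j := by
  funext B
  obtain ⟨a, ha⟩ := B.2.1
  exact (((p.mem_upperT).1 hi).2 a B ha).symm.trans (((p.mem_upperT).1 hj).2 a B ha)

/-- A through-block meets both rows, so a labeling of either row alone already determines the index.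
-/
theorem lowerT_index_unique {t' : Fin p.l → Fin N} {i j : p.ThroughBlock → Fin N}
    (hi : t' ∈ p.lowerT N i) (hj : t' ∈ p.lowerT N j) : i = j := by
  funext B
  obtain ⟨b, hb⟩ := B.2.2
  exact (((p.mem_lowerT).1 hi).2 b B hb).symm.trans (((p.mem_lowerT).1 hj).2 b B hb)

open Classical in
/-- Replace the labels on the through-blocks of a labeling of the upper row by those of `j`. -/
noncomputable def relabel (j : p.ThroughBlock → Fin N) (t : Fin p.k → Fin N) : Fin p.k → Fin N := fun a =>
  if h : ∃ B : p.ThroughBlock, p.upperBlock a = B.1 then j h.choose else t a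

theorem relabel_of_through (j : p.ThroughBlock → Fin N) (t : Fin p.k → Fin N) {a : Fin p.k}
    {B : p.ThroughBlock} (h : p.upperBlock a = B.1) : p.relabel j t a = j B := by
  have h' : ∃ B : p.ThroughBlock, p.upperBlock a = B.1 := ⟨B, h⟩
  rw [relabel, dif_pos h', Subtype.ext (h'.choose_spec.symm.trans h)]

theorem relabel_of_not_through (j : p.ThroughBlock → Fin N) (t : Fin p.k → Fin N) {a : Fin p.k}
    (h : ¬ ∃ B : p.ThroughBlock, p.upperBlock a = B.1) : p.relabel j t a = t a := by
  rw [relabel, dif_neg h]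

theorem relabel_mem_upperT {t : Fin p.k → Fin N} (ht : p.UpperValid t)
    (j : p.ThroughBlock → Fin N) : p.relabel j t ∈ p.upperT N j := by
  refine (p.mem_upperT).2 ⟨fun a a' h => ?_, fun a B h => p.relabel_of_through j t h⟩
  by_cases hB : ∃ B : p.ThroughBlock, p.upperBlock a = B.1
  · obtain ⟨B, hB⟩ := hB
    rw [p.relabel_of_through j t hB, p.relabel_of_through j t (h ▸ hB)]
  · rw [p.relabel_of_not_through j t hB, p.relabel_of_not_through j t (h ▸ hB), ht a a' h]

theorem upperT_nonempty [NeZero N] (i : p.ThroughBlock → Fin N) : (p.upperT N i).Nonempty :=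
  ⟨_, p.relabel_mem_upperT (t := fun _ => 0) (fun _ _ _ => rfl) i⟩

open Classical in
theorem lowerT_nonempty [NeZero N] (i : p.ThroughBlock → Fin N) : (p.lowerT N i).Nonempty := by
  -- Labeling blocks instead of points makes validity automatic; the label `0` outside the
  -- through-blocks is arbitrary.
  let f : Quotient p.blocks → Fin N := fun B =>
    if h : (∃ a, p.upperBlock a = B) ∧ ∃ b, p.lowerBlock b = B then i ⟨B, h⟩ else 0
  refine ⟨fun b => f (p.lowerBlock b), (p.mem_lowerT).2
    ⟨fun b b' h => congrArg f h, fun b B h => ?_⟩⟩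
  rw [h]
  exact dif_pos B.2

/-- Labels off the through-blocks are chosen independently of the index. Relabeling forgets only the
labels on the through-blocks, which all members of `T_i` share, so it is injective on `T_i`. -/
theorem card_upperT_le (i j : p.ThroughBlock → Fin N) :
    (p.upperT N i).card ≤ (p.upperT N j).card := by
  refine Finset.card_le_card_of_injOn (p.relabel j)
    (fun t ht => p.relabel_mem_upperT ((p.mem_upperT).1 ht).1 j) fun t ht s hs h => ?_
  funext a
  by_cases hB : ∃ B : p.ThroughBlock, p.upperBlock a = B.1
  · obtain ⟨B, hB⟩ := hB
    rw [((p.mem_upperT).1 ht).2 a B hB, ((p.mem_upperT).1 hs).2 a B hB]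
  · simpa only [p.relabel_of_not_through j _ hB] using congrFun h a

theorem card_upperT (i j : p.ThroughBlock → Fin N) :
    (p.upperT N i).card = (p.upperT N j).card :=
  le_antisymm (p.card_upperT_le i j) (p.card_upperT_le j i)

end ColouredPartition

/-! ### The intertwiner of a partition -/

section Intertwiner

open Classical in
/-- The matrix of a partition: the entry of a pair of labelings is `1` if both are valid and they
agree on the through-blocks, and `0` otherwise. -/
noncomputable def intertwiner (A : Type*) [Ring A] (N : ℕ) (p : ColouredPartition) :
    Matrix (Fin p.l → Fin N) (Fin p.k → Fin N) A :=
  Matrix.of fun t' t => if ∃ i, t ∈ p.upperT N i ∧ t' ∈ p.lowerT N i then 1 else 0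

variable {A : Type*} [Ring A] {N : ℕ} (p : ColouredPartition)

/-- Uniqueness of the index collapses the existential, so a row of the matrix is the indicator of a
single `T_i`. This turns matrix products into the sums in the relations. -/
theorem intertwiner_of_mem_lowerT {i : p.ThroughBlock → Fin N} {t' : Fin p.l → Fin N}
    (ht' : t' ∈ p.lowerT N i) (t : Fin p.k → Fin N) [Decidable (t ∈ p.upperT N i)] :
    intertwiner A N p t' t = if t ∈ p.upperT N i then 1 else 0 := by
  classical
  rw [intertwiner, Matrix.of_apply]
  refine if_congr ⟨?_, fun h => ⟨i, h, ht'⟩⟩ rfl rfl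
  rintro ⟨j, h, h'⟩
  rwa [p.lowerT_index_unique ht' h']

theorem intertwiner_of_mem_upperT {i : p.ThroughBlock → Fin N} {t : Fin p.k → Fin N}
    (ht : t ∈ p.upperT N i) (t' : Fin p.l → Fin N) [Decidable (t' ∈ p.lowerT N i)] :
    intertwiner A N p t' t = if t' ∈ p.lowerT N i then 1 else 0 := by
  classical
  rw [intertwiner, Matrix.of_apply]
  refine if_congr ⟨?_, fun h => ⟨i, ht, h⟩⟩ rfl rfl
  rintro ⟨j, h, h'⟩
  rwa [p.upperT_index_unique ht h]

theorem intertwiner_of_not_lowerValid {t' : Fin p.l → Fin N} (ht' : ¬ p.LowerValid t')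
    (t : Fin p.k → Fin N) : intertwiner A N p t' t = 0 := by
  rw [intertwiner, Matrix.of_apply, if_neg]
  rintro ⟨i, -, h⟩
  exact ht' ((p.mem_lowerT).1 h).1

theorem intertwiner_of_not_upperValid {t : Fin p.k → Fin N} (ht : ¬ p.UpperValid t)
    (t' : Fin p.l → Fin N) : intertwiner A N p t' t = 0 := by
  rw [intertwiner, Matrix.of_apply, if_neg]
  rintro ⟨i, h, -⟩
  exact ht ((p.mem_upperT).1 h).1

end Intertwiner

/-! ### Tensor powers of a matrix -/

section TensorPower

variable {A : Type*} [Ring A] [StarRing A] {N : ℕ}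

/-- The tensor power `u ^ ω`, whose entries are the words in the entries of `u`. -/
def tensorPower {n : ℕ} (ω : Fin n → Colour) (u : Fin N → Fin N → A) :
    Matrix (Fin n → Fin N) (Fin n → Fin N) A :=
  Matrix.of fun t γ => word ω fun m => u (t m) (γ m)

theorem word_succ {n : ℕ} (ω : Fin (n + 1) → Colour) (y : Fin (n + 1) → A) :
    word ω y = (ω 0).pow (y 0) * word (fun m => ω m.succ) fun m => y m.succ := by
  simp [word, List.ofFn_succ]

theorem sum_fin_succ_pi {M : Type*} [AddCommMonoid M] {n : ℕ} (f : (Fin (n + 1) → Fin N) → M) :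
    ∑ t, f t = ∑ s : Fin N, ∑ t : Fin n → Fin N, f (Fin.cons s t) := by
  rw [← Fintype.sum_prod_type', ← (Fin.consEquiv fun _ => Fin N).sum_comp]
  rfl

theorem Colour.star_pow (c : Colour) (a : A) : star (c.pow a) = c.flip.pow a := by
  cases c
  · rfl
  · exact star_star a

/-- The tensor powers have a right inverse if `u` and its conjugate have one. -/
theorem tensorPower_mul_conjTranspose {u : Fin N → Fin N → A}
    (hu : ∀ (c : Colour) (i j : Fin N),
      ∑ s, c.pow (u i s) * c.flip.pow (u j s) = if i = j then 1 else 0)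
    {n : ℕ} (ω : Fin n → Colour) : tensorPower ω u * (tensorPower ω u)ᴴ = 1 := by
  ext t t'
  rw [Matrix.mul_apply, Matrix.one_apply]
  simp only [tensorPower, Matrix.conjTranspose_apply, Matrix.of_apply]
  induction n with
  | zero => simp [word, Subsingleton.elim t t']
  | succ n ih =>
    have ih' := ih (fun m => ω m.succ) (fun m => t m.succ) (fun m => t' m.succ)
    simp only [word_succ, sum_fin_succ_pi, Fin.cons_zero, Fin.cons_succ, star_mul,
      Colour.star_pow]
    -- The product has the shape `a w w'* a'*`: the remaining letters stand in the middle and are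
    -- summed first, by induction; the first letter is left.
    calc _ = ∑ s, (ω 0).pow (u (t 0) s) * (∑ γ : Fin n → Fin N,
          word (fun m => ω m.succ) (fun m => u (t m.succ) (γ m)) *
            star (word (fun m => ω m.succ) (fun m => u (t' m.succ) (γ m)))) *
          (ω 0).flip.pow (u (t' 0) s) := by
          simp only [Finset.mul_sum, Finset.sum_mul, mul_assoc]
      _ = _ := by
          rw [ih']
          have key : t = t' ↔ t 0 = t' 0 ∧ (fun m => t (Fin.succ m)) = fun m => t' (Fin.succ m) := by
            simp only [funext_iff, Fin.forall_fin_succ]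
          by_cases h : (fun m => t (Fin.succ m)) = fun m => t' (Fin.succ m)
          · simp only [if_pos h, mul_one, hu, key, and_iff_left h]
          · simp [key, h]

/-- The tensor powers have a left inverse if `u` and its conjugate have one. -/
theorem conjTranspose_mul_tensorPower {u : Fin N → Fin N → A}
    (hu : ∀ (c : Colour) (i j : Fin N),
      ∑ s, c.flip.pow (u s i) * c.pow (u s j) = if i = j then 1 else 0)
    {n : ℕ} (ω : Fin n → Colour) : (tensorPower ω u)ᴴ * tensorPower ω u = 1 := by
  ext t t'
  rw [Matrix.mul_apply, Matrix.one_apply]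
  simp only [tensorPower, Matrix.conjTranspose_apply, Matrix.of_apply]
  induction n with
  | zero => simp [word, Subsingleton.elim t t']
  | succ n ih =>
    have ih' := ih (fun m => ω m.succ) (fun m => t m.succ) (fun m => t' m.succ)
    simp only [word_succ, sum_fin_succ_pi, Fin.cons_zero, Fin.cons_succ, star_mul,
      Colour.star_pow]
    -- Here the shape is `w* a* a' w'`, with the first letter in the middle, so its sum has to
    -- become the inner one.
    rw [Finset.sum_comm]
    calc _ = ∑ γ : Fin n → Fin N,
          star (word (fun m => ω m.succ) (fun m => u (γ m) (t m.succ))) *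
          (∑ s, (ω 0).flip.pow (u s (t 0)) * (ω 0).pow (u s (t' 0))) *
          word (fun m => ω m.succ) (fun m => u (γ m) (t' m.succ)) := by
          simp only [Finset.mul_sum, Finset.sum_mul, mul_assoc]
      _ = _ := by
          have key : t = t' ↔ t 0 = t' 0 ∧ (fun m => t (Fin.succ m)) = fun m => t' (Fin.succ m) := by
            simp only [funext_iff, Fin.forall_fin_succ]
          rw [hu]
          by_cases h : t 0 = t' 0
          · simp only [if_pos h, mul_one, ih', key, and_iff_right h]
          · simp [key, h]

variable (p : ColouredPartition)

theorem star_intertwiner (t' : Fin p.l → Fin N) (t : Fin p.k → Fin N) :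
    star (intertwiner A N p t' t) = intertwiner A N p t' t := by
  rw [intertwiner, Matrix.of_apply]
  split_ifs <;> simp

/-- The quantum group relations of `p` say that `intertwiner A N p` intertwines the tensor
powers. -/
theorem intertwiner_mul_tensorPower {u : Fin N → Fin N → A}
    (hu : ∀ a b, GroupRel p u a b → a = b) :
    intertwiner A N p * tensorPower p.ω u = tensorPower p.ω' u * intertwiner A N p := by
  classical
  ext γ' γ
  rw [Matrix.mul_apply, Matrix.mul_apply]
  -- Each case with a valid index is one of the three group relations; if both are invalid, both
  -- entries vanish.
  by_cases h' : p.LowerValid γ' <;> by_cases h : p.UpperValid γ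
  · obtain ⟨i, hi⟩ := h'.exists_mem_lowerT
    obtain ⟨j, hj⟩ := h.exists_mem_upperT
    simpa [intertwiner_of_mem_lowerT p hi, intertwiner_of_mem_upperT p hj, tensorPower]
      using hu _ _ (.through i j γ γ' hj hi)
  · obtain ⟨i, hi⟩ := h'.exists_mem_lowerT
    simpa [intertwiner_of_mem_lowerT p hi, intertwiner_of_not_upperValid p h, tensorPower]
      using hu _ _ (.upper i γ h)
  · obtain ⟨j, hj⟩ := h.exists_mem_upperT
    simpa [intertwiner_of_mem_upperT p hj, intertwiner_of_not_lowerValid p h', tensorPower]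
      using (hu _ _ (.lower j γ' h')).symm
  · simp [intertwiner_of_not_lowerValid p h', intertwiner_of_not_upperValid p h]

end TensorPower

/-! ### The mixed-coloured pair partitions make the matrix and its conjugate unitary -/

section Pairs

variable {A : Type*} [Ring A] [StarRing A] {N : ℕ}

instance (c c' : Colour) : IsEmpty (upperPair c c').ThroughBlock :=
  ⟨fun B => B.2.2.choose.elim0⟩

theorem fin_two_valid_iff (t : Fin 2 → Fin N) : (∀ a b, t a = t b) ↔ t 0 = t 1 := by
  refine ⟨fun h => h 0 1, fun h a b => ?_⟩
  fin_cases a <;> fin_cases b <;> simp [h]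

theorem lowerValid_lowerPair (c c' : Colour) (t : Fin 2 → Fin N) :
    (lowerPair c c').LowerValid t ↔ t 0 = t 1 := by
  rw [← fin_two_valid_iff]
  exact ⟨fun h a b => h a b (Quotient.sound trivial), fun h a b _ => h a b⟩

theorem upperValid_upperPair (c c' : Colour) (t : Fin 2 → Fin N) :
    (upperPair c c').UpperValid t ↔ t 0 = t 1 := by
  rw [← fin_two_valid_iff]
  exact ⟨fun h a b => h a b (Quotient.sound trivial), fun h a b _ => h a b⟩

theorem mem_upperT_upperPair (c c' : Colour) (i : (upperPair c c').ThroughBlock → Fin N)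
    (t : Fin (upperPair c c').k → Fin N) :
    t ∈ (upperPair c c').upperT N i ↔ t (0 : Fin 2) = t (1 : Fin 2) := by
  rw [mem_upperT]
  exact ⟨fun h => (upperValid_upperPair c c' t).1 h.1,
    fun h => ⟨(upperValid_upperPair c c' t).2 h, fun _ B => isEmptyElim B⟩⟩

theorem mem_lowerT_upperPair (c c' : Colour) (i : (upperPair c c').ThroughBlock → Fin N)
    (t : Fin (upperPair c c').l → Fin N) : t ∈ (upperPair c c').lowerT N i := by
  rw [mem_lowerT]
  exact ⟨fun a => Fin.elim0 a, fun a => Fin.elim0 a⟩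

theorem sum_lowerT_upperPair (c c' : Colour) (i : (upperPair c c').ThroughBlock → Fin N)
    (y : (Fin (upperPair c c').l → Fin N) → Fin (upperPair c c').l → A) :
    ∑ t ∈ (upperPair c c').lowerT N i, word (upperPair c c').ω' (y t) = 1 := by
  refine (Finset.sum_eq_single_of_mem (fun a => Fin.elim0 a) (mem_lowerT_upperPair c c' i _)
    fun t _ ht => (ht (funext fun a => Fin.elim0 a)).elim).trans ?_
  rfl

theorem sum_fin_two_diagonal {M : Type*} [AddCommMonoid M] (S : Finset (Fin 2 → Fin N))
    (hS : ∀ t, t ∈ S ↔ t 0 = t 1) (f : (Fin 2 → Fin N) → M) :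
    ∑ t ∈ S, f t = ∑ s, f fun _ => s := by
  symm
  refine Finset.sum_bij (fun s _ => fun _ => s) (fun s _ => (hS _).2 rfl)
    (fun s _ s' _ h => congrFun h 0) (fun t ht => ?_) fun _ _ => rfl
  exact ⟨t 0, Finset.mem_univ _, funext fun m => (fin_two_valid_iff t).2 ((hS t).1 ht) 0 m⟩

theorem word_two (c c' : Colour) (y : Fin 2 → A) :
    word ![c, c'] y = c.pow (y 0) * c'.pow (y 1) := by
  simp [word]

/-- The upper row is empty and contributes the empty word `1`. The through relation gives the
diagonal entries, the vanishing relation the others: for mixed colours this is orthonormality of the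
rows of `u` or of its conjugate. -/
theorem sum_of_lowerPair {c c' : Colour} {u : Fin N → Fin N → A}
    (hu : ∀ a b, GroupRel (lowerPair c c') u a b → a = b) (i j : Fin N) :
    ∑ s, c.pow (u i s) * c'.pow (u j s) = if i = j then 1 else 0 := by
  have hsum : ∑ t' ∈ (lowerPair c c').lowerT N isEmptyElim,
      word (lowerPair c c').ω' (fun m => u ((![i, j] : Fin 2 → Fin N) m) (t' m)) =
      ∑ s, c.pow (u i s) * c'.pow (u j s) :=
    (sum_fin_two_diagonal _ (mem_lowerT_lowerPair c c' _) _).trans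
      (Finset.sum_congr rfl fun s _ => word_two c c' _)
  rw [← hsum]
  split_ifs with h
  · have := hu _ _ (.through isEmptyElim isEmptyElim (fun a => Fin.elim0 a) ![i, j]
      (mem_upperT_lowerPair c c' _ _) ((mem_lowerT_lowerPair c c' _ _).2 h))
    rwa [sum_upperT_lowerPair, eq_comm] at this
  · exact hu _ _ (.lower isEmptyElim ![i, j] fun hv => h ((lowerValid_lowerPair c c' _).1 hv))

/-- The mirror image, giving orthonormality of the columns. -/
theorem sum_of_upperPair {c c' : Colour} {u : Fin N → Fin N → A}
    (hu : ∀ a b, GroupRel (upperPair c c') u a b → a = b) (i j : Fin N) :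
    ∑ s, c.pow (u s i) * c'.pow (u s j) = if i = j then 1 else 0 := by
  have hsum : ∑ t ∈ (upperPair c c').upperT N isEmptyElim,
      word (upperPair c c').ω (fun m => u (t m) ((![i, j] : Fin 2 → Fin N) m)) =
      ∑ s, c.pow (u s i) * c'.pow (u s j) :=
    (sum_fin_two_diagonal _ (mem_upperT_upperPair c c' _) _).trans
      (Finset.sum_congr rfl fun s _ => word_two c c' _)
  rw [← hsum]
  split_ifs with h
  · have := hu _ _ (.through isEmptyElim isEmptyElim ![i, j] (fun a => Fin.elim0 a)
      ((mem_upperT_upperPair c c' _ _).2 h) (mem_lowerT_upperPair c c' _ _))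
    rwa [sum_lowerT_upperPair] at this
  · exact hu _ _ (.upper isEmptyElim ![i, j] fun hv => h ((upperValid_upperPair c c' _).1 hv))

end Pairs

/-! ### The quantum group relations imply the quantum space relations -/

section Implication

variable {A : Type*} [Ring A] [StarRing A] {N : ℕ} {u : Fin N → Fin N → A}

/-- The relations of the pair partitions allow to reflect the relations of `p`. -/
theorem tensorPower_mul_conjTranspose_intertwiner
    (hpair : ∀ q ∈ mixedPairs, ∀ a b, GroupRel q u a b → a = b) (p : ColouredPartition)
    (hu : ∀ a b, GroupRel p u a b → a = b) :
    tensorPower p.ω u * (intertwiner A N p)ᴴ = (intertwiner A N p)ᴴ * tensorPower p.ω' u := by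
  have h := congrArg Matrix.conjTranspose (intertwiner_mul_tensorPower p hu)
  rw [Matrix.conjTranspose_mul, Matrix.conjTranspose_mul] at h
  have h₁ : tensorPower p.ω u * (tensorPower p.ω u)ᴴ = 1 :=
    tensorPower_mul_conjTranspose (fun c => sum_of_lowerPair (hpair _ (by
      cases c <;> simp [mixedPairs, Colour.flip]))) p.ω
  have h₂ : (tensorPower p.ω' u)ᴴ * tensorPower p.ω' u = 1 :=
    conjTranspose_mul_tensorPower (fun c => sum_of_upperPair (hpair _ (by
      cases c <;> simp [mixedPairs, Colour.flip]))) p.ω'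
  -- The adjoint equation is multiplied by `u^ω` on the left and by `u^ω'` on the right; only `u^ω
  -- (u^ω)* = 1` and `(u^ω')* u^ω' = 1` are needed.
  calc tensorPower p.ω u * (intertwiner A N p)ᴴ
      = tensorPower p.ω u * ((intertwiner A N p)ᴴ * (tensorPower p.ω' u)ᴴ) *
          tensorPower p.ω' u := by
        rw [Matrix.mul_assoc, Matrix.mul_assoc, h₂, Matrix.mul_one]
    _ = (intertwiner A N p)ᴴ * tensorPower p.ω' u := by
        rw [← h, ← Matrix.mul_assoc, h₁, Matrix.one_mul]

/-- This is the entry of the reflected equation at `γ`, `γ'`; the entries of the intertwiner are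
self-adjoint, so its adjoint is its transpose. -/
theorem sum_lowerT_eq_sum_upperT
    (hpair : ∀ q ∈ mixedPairs, ∀ a b, GroupRel q u a b → a = b) (p : ColouredPartition)
    (hu : ∀ a b, GroupRel p u a b → a = b) {i j : p.ThroughBlock → Fin N}
    {γ : Fin p.k → Fin N} {γ' : Fin p.l → Fin N} (hγ : γ ∈ p.upperT N i)
    (hγ' : γ' ∈ p.lowerT N j) :
    ∑ t' ∈ p.lowerT N i, word p.ω' (fun m => u (t' m) (γ' m)) =
      ∑ t ∈ p.upperT N j, word p.ω fun m => u (γ m) (t m) := by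
  classical
  have h := congrFun (congrFun (tensorPower_mul_conjTranspose_intertwiner hpair p hu) γ) γ'
  simp only [Matrix.mul_apply, Matrix.conjTranspose_apply, star_intertwiner] at h
  simpa [intertwiner_of_mem_upperT p hγ, intertwiner_of_mem_lowerT p hγ',
    tensorPower] using h.symm

/-- The same entry at an invalid `γ'`, where the column of the adjoint intertwiner has the wrong
support: the other side is zero. The labeling `γ` serves only to select the index `i`. -/
theorem sum_lowerT_eq_zero
    (hpair : ∀ q ∈ mixedPairs, ∀ a b, GroupRel q u a b → a = b) (p : ColouredPartition)
    (hu : ∀ a b, GroupRel p u a b → a = b) {i : p.ThroughBlock → Fin N}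
    {γ : Fin p.k → Fin N} {γ' : Fin p.l → Fin N} (hγ : γ ∈ p.upperT N i)
    (hγ' : ¬ p.LowerValid γ') :
    ∑ t' ∈ p.lowerT N i, word p.ω' (fun m => u (t' m) (γ' m)) = 0 := by
  classical
  have h := congrFun (congrFun (tensorPower_mul_conjTranspose_intertwiner hpair p hu) γ) γ'
  simp only [Matrix.mul_apply, Matrix.conjTranspose_apply, star_intertwiner] at h
  simpa [intertwiner_of_mem_upperT p hγ, intertwiner_of_not_lowerValid p hγ',
    tensorPower] using h.symm

/-- Both sides equal the average of the words `u_{tγ} ^ ω` with `t ∈ T_i` and `γ ∈ T_j`. -/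
theorem sum_upperT_eq_sum_lowerT [Algebra ℂ A] [NeZero N]
    (hpair : ∀ q ∈ mixedPairs, ∀ a b, GroupRel q u a b → a = b) (p : ColouredPartition)
    (hu : ∀ a b, GroupRel p u a b → a = b) {i j : p.ThroughBlock → Fin N}
    {γ : Fin p.k → Fin N} {γ' : Fin p.l → Fin N} (hγ : γ ∈ p.upperT N j)
    (hγ' : γ' ∈ p.lowerT N j) :
    ∑ t ∈ p.upperT N i, word p.ω (fun m => u (t m) (γ m)) =
      ∑ t' ∈ p.lowerT N i, word p.ω' fun m => u (t' m) (γ' m) := by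
  obtain ⟨δ', hδ'⟩ := p.lowerT_nonempty i
  -- Both column sums equal the row sum at the auxiliary `δ'`, which does not involve `δ` or `γ`.
  have h₁ : ∀ δ ∈ p.upperT N j, ∑ t ∈ p.upperT N i, word p.ω (fun m => u (t m) (δ m)) =
      ∑ t ∈ p.upperT N i, word p.ω (fun m => u (t m) (γ m)) := fun δ hδ =>
    (hu _ _ (.through i j δ δ' hδ hδ')).trans (hu _ _ (.through i j γ δ' hγ hδ')).symm
  have h₂ : ∀ δ ∈ p.upperT N i, ∑ t ∈ p.upperT N j, word p.ω (fun m => u (δ m) (t m)) =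
      ∑ t' ∈ p.lowerT N i, word p.ω' (fun m => u (t' m) (γ' m)) := fun δ hδ =>
    (sum_lowerT_eq_sum_upperT hpair p hu hδ hγ').symm
  -- Double count over `T_i × T_j`: constant column sums on one side, constant row sums on the
  -- other.
  have h := (Finset.sum_congr rfl h₁).symm.trans
    (Finset.sum_comm.trans (Finset.sum_congr rfl h₂))
  rw [Finset.sum_const, Finset.sum_const, p.card_upperT j i, ← Nat.cast_smul_eq_nsmul ℂ,
    ← Nat.cast_smul_eq_nsmul ℂ] at h
  have hne : ((p.upperT N i).card : ℂ) ≠ 0 :=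
    Nat.cast_ne_zero.2 (Finset.card_pos.2 (p.upperT_nonempty i)).ne'
  exact (isUnit_iff_ne_zero.2 hne).smul_left_cancel.1 h

theorem eq_of_spaceRel [Algebra ℂ A] [NeZero N]
    (hpair : ∀ q ∈ mixedPairs, ∀ a b, GroupRel q u a b → a = b) (p : ColouredPartition)
    (hu : ∀ a b, GroupRel p u a b → a = b) {d : ℕ} (hdN : d ≤ N) {a b : A}
    (h : SpaceRel p hdN (fun i j => u i (Fin.castLE hdN j)) a b) : a = b := by
  cases h with
  | through i j γ γ' hγ hγ' => exact sum_upperT_eq_sum_lowerT hpair p hu hγ hγ'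
  | upper i γ hγ => exact hu _ _ (.upper i _ hγ)
  | lower i γ' hγ' =>
    -- The relation involves no upper labeling, so any element of `T_i` can select the row of the
    -- reflected equation.
    obtain ⟨γ, hγ⟩ := p.upperT_nonempty i
    exact sum_lowerT_eq_zero hpair p hu hγ hγ'

theorem eq_of_vectorRel [Algebra ℂ A] [NeZero N]
    (hpair : ∀ q ∈ mixedPairs, ∀ a b, GroupRel q u a b → a = b) (p : ColouredPartition)
    (hu : ∀ a b, GroupRel p u a b → a = b) (j : Fin N) {a b : A}
    (h : VectorRel p (fun i => u i j) a b) : a = b := by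
  cases h with
  | through i =>
    -- Using the single column `j` means taking constant column labelings, which are valid and give
    -- every through-block the label `j`.
    exact sum_upperT_eq_sum_lowerT hpair p hu (i := i) (j := fun _ => j)
      ((p.mem_upperT).2 ⟨fun _ _ _ => rfl, fun _ _ _ => rfl⟩)
      ((p.mem_lowerT).2 ⟨fun _ _ _ => rfl, fun _ _ _ => rfl⟩)

end Implication

/-! ### The universal property -/

section Lift

variable {ι : Type*} {B : Type*} [Ring B] [StarRing B]

namespace FreeStarAlgebra

/-- The monoid homomorphism on words that sends the generators to `y`. -/
def wordLift (y : ι → B) : FreeMonoid (ι × Colour) →* B :=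
  FreeMonoid.lift fun s => s.2.pow (y s.1)

theorem wordLift_wordStar (y : ι → B) (w : FreeMonoid (ι × Colour)) :
    wordLift y (wordStar w) = star (wordLift y w) := by
  induction w using FreeMonoid.inductionOn with
  | one =>
    have h : wordStar (1 : FreeMonoid (ι × Colour)) = 1 := rfl
    rw [h, map_one, star_one]
  | of s =>
    have h : wordStar (FreeMonoid.of s) = FreeMonoid.of (s.1, s.2.flip) := rfl
    rw [h, wordLift, FreeMonoid.lift_eval_of, FreeMonoid.lift_eval_of, Colour.star_pow]
  | mul v w hv hw => rw [wordStar_mul, map_mul, map_mul, hv, hw, star_mul]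

variable [Algebra ℂ B]

/-- The ⋆-homomorphism on the free ⋆-algebra that sends the generators to `y`. -/
noncomputable def lift [StarModule ℂ B] (y : ι → B) : FreeStarAlgebra ι →⋆ₐ[ℂ] B where
  __ := MonoidAlgebra.lift ℂ B (FreeMonoid (ι × Colour)) (wordLift y)
  map_star' f := by
    change MonoidAlgebra.lift ℂ B (FreeMonoid (ι × Colour)) (wordLift y) (starHom f) =
      star (MonoidAlgebra.lift ℂ B (FreeMonoid (ι × Colour)) (wordLift y) f)
    induction f using MonoidAlgebra.induction_linear with
    | zero => simp
    | add f g hf hg => rw [map_add, map_add, map_add, star_add, hf, hg]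
    | single w c =>
      rw [starHom_single, MonoidAlgebra.lift_single, MonoidAlgebra.lift_single,
        wordLift_wordStar, star_smul]

theorem lift_gen [StarModule ℂ B] (y : ι → B) (i : ι) : lift y (gen i) = y i := by
  change MonoidAlgebra.lift ℂ B (FreeMonoid (ι × Colour)) (wordLift y) (gen i) = y i
  rw [gen, MonoidAlgebra.lift_single, one_smul]
  rfl

theorem single_black (i : ι) :
    (MonoidAlgebra.single (FreeMonoid.of (i, Colour.black)) 1 : FreeStarAlgebra ι) =
      star (gen i) := by
  change _ = starHom _
  rw [gen, starHom_single, star_one]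
  rfl

/-- As an algebra, the free ⋆-algebra is generated by letters of both colours; agreement on the
black ones follows from compatibility with the involution. -/
theorem hom_ext {f g : FreeStarAlgebra ι →⋆ₐ[ℂ] B} (h : ∀ i, f (gen i) = g (gen i)) : f = g := by
  have key : (f : FreeStarAlgebra ι →ₐ[ℂ] B) = (g : FreeStarAlgebra ι →ₐ[ℂ] B) := by
    refine MonoidAlgebra.algHom_ext' (FreeMonoid.hom_eq fun s => ?_) (Subsingleton.elim _ _)
    obtain ⟨i, c⟩ := s
    change f (MonoidAlgebra.single _ 1) = g (MonoidAlgebra.single _ 1)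
    cases c with
    | white => exact h i
    | black => rw [single_black, map_star, map_star, h]
  exact StarAlgHom.ext fun a => DFunLike.congr_fun key a

end FreeStarAlgebra

end Lift

/-! ### Extending contractive ⋆-homomorphisms to the completion -/

namespace CStarSeminorm

variable {A : Type*} [Ring A] [StarRing A] [Algebra ℂ A]

/-- The canonical map to the completion as a ⋆-homomorphism. -/
def ofHom (p : CStarSeminorm A) : A →⋆ₐ[ℂ] p.Completion where
  toFun := p.of
  map_one' := p.of_one
  map_mul' := p.of_mul
  map_zero' := rfl
  map_add' := p.of_add
  commutes' c := by
    rw [Algebra.algebraMap_eq_smul_one, of_smul, of_one, Algebra.algebraMap_eq_smul_one]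
  map_star' a := (p.star_of a).symm

/-- The seminorm induced by a ⋆-homomorphism to a C⋆-algebra. -/
def comap {B : Type*} [CStarAlgebra B] (f : A →⋆ₐ[ℂ] B) : CStarSeminorm A where
  toFun a := ‖f a‖
  map_zero' := by simp
  add_le' a b := by simpa using norm_add_le (f a) (f b)
  neg' a := by simp
  smul' c a := by simp [norm_smul]
  mul_le' a b := by simpa using norm_mul_le (f a) (f b)
  star_mul_self' a := by rw [map_mul, StarHomClass.map_star, CStarRing.norm_star_mul_self, sq]

/-- A ⋆-homomorphism on `A` as a ring homomorphism on the seminormed algebra. -/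
def carrierHom {B : Type*} [CStarAlgebra B] (p : CStarSeminorm A) (f : A →⋆ₐ[ℂ] B) :
    p.Carrier →+* B :=
  (f : A →+* B)

theorem continuous_carrierHom {B : Type*} [CStarAlgebra B] (p : CStarSeminorm A)
    (f : A →⋆ₐ[ℂ] B) (hf : ∀ a, ‖f a‖ ≤ p a) : Continuous (p.carrierHom f) :=
  AddMonoidHomClass.continuous_of_bound (p.carrierHom f) 1 fun a => (hf a).trans (one_mul _).ge

/-- The extension of a contractive ⋆-homomorphism to the completion. -/
noncomputable def extend {B : Type*} [CStarAlgebra B] (p : CStarSeminorm A)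
    (f : A →⋆ₐ[ℂ] B) (hf : ∀ a, ‖f a‖ ≤ p a) : p.Completion →⋆ₐ[ℂ] B :=
  have hc := p.continuous_carrierHom f hf
  have hof : ∀ a : A, UniformSpace.Completion.extensionHom
      (p.carrierHom f) hc (p.of a) = f a :=
    fun a => UniformSpace.Completion.extensionHom_coe _ hc a
  have hcont : Continuous (UniformSpace.Completion.extensionHom
      (p.carrierHom f) hc) := UniformSpace.Completion.continuous_extension
  { UniformSpace.Completion.extensionHom (p.carrierHom f) hc with
    commutes' := fun c => by
      have h : (algebraMap ℂ p.Completion c) = p.of (algebraMap ℂ A c) := by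
        rw [Algebra.algebraMap_eq_smul_one, Algebra.algebraMap_eq_smul_one, of_smul, of_one]
      rw [h]
      exact (hof _).trans (AlgHomClass.commutes f c)
    map_star' := fun a => by
      refine p.completion_induction a (P := fun a => UniformSpace.Completion.extensionHom
          (p.carrierHom f) hc (star a) =
        star (UniformSpace.Completion.extensionHom
          (p.carrierHom f) hc a)) (isClosed_eq ?_ ?_) fun a => ?_
      · exact hcont.comp p.continuous_star_completion
      · exact continuous_star.comp hcont
      · rw [star_of, hof, hof, StarHomClass.map_star] }

theorem extend_of {B : Type*} [CStarAlgebra B] (p : CStarSeminorm A)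
    (f : A →⋆ₐ[ℂ] B) (hf : ∀ a, ‖f a‖ ≤ p a) (a : A) : p.extend f hf (p.of a) = f a :=
  UniformSpace.Completion.extensionHom_coe (α := p.Carrier) _ (p.continuous_carrierHom f hf) a

end CStarSeminorm

/-! ### Relations and homomorphisms of the universal C⋆-algebra -/

namespace UniversalCStarAlgebra

open scoped CStarAlgebra

variable {ι : Type*} {R : FreeStarAlgebra ι → FreeStarAlgebra ι → Prop}

/-- The relations hold in the universal C⋆-algebra. -/
theorem of_eq_of_rel (hR : BoundedRelations R) {a b : FreeStarAlgebra ι} (h : R a b) :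
    (universalSeminorm hR).ofHom a = (universalSeminorm hR).ofHom b := by
  rw [← sub_eq_zero, ← map_sub, ← norm_eq_zero]
  refine ((universalSeminorm hR).norm_of (a - b)).trans ?_
  change ⨆ p : AdmissibleSeminorm R, p.1 (a - b) = 0
  have h0 : ∀ p : AdmissibleSeminorm R, p.1 (a - b) = 0 := fun p => p.2 a b h
  simp [h0]

/-- A family in a C⋆-algebra that satisfies the relations is the image of the generators under
a unique ⋆-homomorphism. -/
theorem existsUnique_hom (hR : BoundedRelations R) {B : Type*} [CStarAlgebra B] (y : ι → B)
    (hy : ∀ a b, R a b → FreeStarAlgebra.lift y a = FreeStarAlgebra.lift y b) :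
    ∃! φ : UniversalCStarAlgebra hR →⋆ₐ[ℂ] B, ∀ i, φ (gen hR i) = y i := by
  -- The norm of `B` pulled back to the free algebra is admissible, hence dominated by the supremum;
  -- this is the contractivity that the extension requires.
  let q : AdmissibleSeminorm R := ⟨CStarSeminorm.comap (FreeStarAlgebra.lift y), fun a b h => by
    change ‖FreeStarAlgebra.lift y (a - b)‖ = 0
    rw [map_sub, hy a b h, sub_self, norm_zero]⟩
  have hle : ∀ a, ‖FreeStarAlgebra.lift y a‖ ≤ universalSeminorm hR a := fun a => hR.le_iSup q a
  refine ⟨(universalSeminorm hR).extend _ hle, fun i => ?_, fun ψ hψ => ?_⟩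
  · exact (CStarSeminorm.extend_of _ _ hle _).trans (FreeStarAlgebra.lift_gen y i)
  -- Uniqueness: ⋆-homomorphisms between C⋆-algebras are continuous, and the image of the free
  -- algebra is dense.
  · have hcomp : ψ.comp (universalSeminorm hR).ofHom = FreeStarAlgebra.lift y :=
      FreeStarAlgebra.hom_ext fun i => (hψ i).trans (FreeStarAlgebra.lift_gen y i).symm
    refine StarAlgHom.ext fun a => ?_
    refine (universalSeminorm hR).completion_induction a
      (P := fun a => ψ a = (universalSeminorm hR).extend _ hle a)
      (isClosed_eq (map_continuous ψ) (map_continuous _)) fun a => ?_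
    exact (DFunLike.congr_fun hcomp a).trans (CStarSeminorm.extend_of _ _ hle a).symm

end UniversalCStarAlgebra

theorem EasyQuantumGroup.eq_of_groupRel (N : ℕ) (P : Set ColouredPartition)
    (hP : mixedPairs ⊆ P) {p : ColouredPartition} (hp : p ∈ P) (a b : EasyQuantumGroup N P hP)
    (h : GroupRel p (EasyQuantumGroup.u N P hP) a b) : a = b := by
  obtain ⟨a, b, hab, rfl, rfl⟩ := GroupRel.exists_of_map
    (universalSeminorm (easyRelations_bounded N hP)).ofHom
    (u := fun i j => FreeStarAlgebra.gen (i, j)) h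
  exact UniversalCStarAlgebra.of_eq_of_rel _ ⟨p, hp, hab⟩

end PartitionQuantumSpace

/-! ### The main theorem -/

open PartitionQuantumSpace in
theorem mainTheorem1 (N d : ℕ) (hd : 1 ≤ d) (hdN : d ≤ N) (P : Set ColouredPartition)
    (hP : ColouredPartition.mixedPairs ⊆ P) :
    (∃! φ : PartitionSpace N d hdN P hP →⋆ₐ[ℂ] EasyQuantumGroup N P hP,
      ∀ (i : Fin N) (j : Fin d), φ (PartitionSpace.x N d hdN P hP i j) =
        EasyQuantumGroup.u N P hP i (Fin.castLE hdN j)) ∧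
    (∃! φ : OneVectorSpace N P hP →⋆ₐ[ℂ] EasyQuantumGroup N P hP,
      ∀ i : Fin N, φ (OneVectorSpace.x N P hP i) =
        EasyQuantumGroup.u N P hP i ⟨0, Nat.lt_of_lt_of_le hd hdN⟩) := by
  have : NeZero N := ⟨(Nat.lt_of_lt_of_le hd hdN).ne'⟩
  have hu : ∀ p ∈ P, ∀ a b, GroupRel p (EasyQuantumGroup.u N P hP) a b → a = b :=
    fun p hp => EasyQuantumGroup.eq_of_groupRel N P hP hp
  have hpair := fun q hq => hu q (hP hq)
  constructor
  · have h := UniversalCStarAlgebra.existsUnique_hom (spaceRelations_bounded N d hdN hP)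
      (fun s => EasyQuantumGroup.u N P hP s.1 (Fin.castLE hdN s.2)) ?_
    · obtain ⟨φ, hφ, hφ'⟩ := h
      exact ⟨φ, fun i j => hφ (i, j), fun ψ hψ => hφ' ψ fun s => hψ s.1 s.2⟩
    · rintro a b ⟨p, hp, hab⟩
      -- The relation among free generators becomes a space relation among the first `d` columns of
      -- `u`.
      have h := hab.map (FreeStarAlgebra.lift fun s : Fin N × Fin d =>
        EasyQuantumGroup.u N P hP s.1 (Fin.castLE hdN s.2))
      simp only [FreeStarAlgebra.lift_gen] at h
      exact eq_of_spaceRel hpair p (hu p hp) hdN h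
  · refine UniversalCStarAlgebra.existsUnique_hom (vectorRelations_bounded N hP)
      (fun i => EasyQuantumGroup.u N P hP i ⟨0, Nat.lt_of_lt_of_le hd hdN⟩) ?_
    rintro a b ⟨p, hp, hab⟩
    have h := hab.map (FreeStarAlgebra.lift fun i : Fin N =>
      EasyQuantumGroup.u N P hP i ⟨0, Nat.lt_of_lt_of_le hd hdN⟩)
    simp only [FreeStarAlgebra.lift_gen] at h
    exact eq_of_vectorRel hpair p (hu p hp) _ h
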